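/- For positive integers $n$ and $a_1,\dots,a_r$ let $$H_n(a_1,\dots,a_r)=\sum_{0<k_1<k_2<\dots<k_r\le n}\frac{1}{k_1^{a_1}k_2^{a_2}\cdots k_r^{a_r}}$$ denote the multiple harmonic sum, and let $B_m$ denote the $m$-th Bernoulli number. For rational numbers $x,y$, a prime $p$ and $m\ge 1$, write $x\equiv y\pmod{p^m}$ if $x-y=p^m c$ for some rational number $c$ whose reduced denominator is not divisible by $p$. Then for every prime $p>5$: \begin{align*} H_{p-1}(2)&\equiv -2\,\frac{H_{p-1}(1)}{p}+\frac{2}{5}\,p^3B_{p-5}\pmod{p^4},\\ H_{\frac{p-1}{2}}(2)&\equiv -7\,\frac{H_{p-1}(1)}{p}+\frac{17}{10}\,p^3B_{p-5}\pmod{p^4},\\ H_{\frac{p-1}{2}}(3)&\equiv 6\,\frac{H_{p-1}(1)}{p^2}-\frac{81}{10}\,p^2B_{p-5}\pmod{p^3},\\ H_{\frac{p-1}{2}}(1,2)+p\,H_{\frac{p-1}{2}}(1,3)&\equiv -\frac{9}{2}\,\frac{H_{p-1}(1)}{p^2}-\frac{49}{20}\,p^2B_{p-5}\pmod{p^3}.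 \end{align*} -/

import Mathlib

/-- The multiple harmonic sum
`H_n(a_1, …, a_r) = ∑_{0 < k_1 < k_2 < ⋯ < k_r ≤ n} 1 / (k_1 ^ a_1 * ⋯ * k_r ^ a_r)`,
as a rational number. -/
def multipleHarmonicSum (n : ℕ) {r : ℕ} (a : Fin r → ℕ) : ℚ :=
  ∑ k ∈ (Fintype.piFinset fun _ : Fin r => Finset.Icc 1 n).filter
      (fun k => ∀ i j : Fin r, i < j → k i < k j),
    1 / ∏ i, (k i : ℚ) ^ a i

/-- Congruence of rational numbers modulo `p ^ m` (for a prime `p`): the difference `x - y` is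
`p ^ m` times a `p`-integral rational number, that is, a rational number whose reduced
denominator is not divisible by `p`. -/
def RatCongr (p m : ℕ) (x y : ℚ) : Prop :=
  ∃ c : ℚ, ¬ p ∣ c.den ∧ x - y = (p : ℚ) ^ m * c

/-! Let `p = 2 * h + 1`, and let S_a and H(a,b) denote the single and double sums up to h. A sum
over 1, …, p-1 folds in two ways: by k ↔ p-k, or by writing its even terms as 2k and its odd terms
as p-2k. Expanding 1/(p-k) in powers of p turns both foldings into combinations of sums up to h, and
equating them gives linear relations. For exponent 4 this yields S_4 ≡ -(31/15) p S_5
(`invPowSum_four_congr`). With exponents 1 and 2 it expresses S_2 and p S_3 through H_{p-1}(1)/p and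
p³ S_5. The same comparison for ∑ k^(p-5), which is p B_{p-5} mod p² by Faulhaber's formula, gives
S_5 ≡ -6 B_{p-5} mod p (`invPowSum_five_congr_bernoulli`). For double sums the parity folding
produces sums over i + j ≤ h. Partial fractions (`tornheimSum_succ_succ`) reduce these to H(a,b),
and the stuffle relation then determines H(1,4) and H(2,3) mod p. Comparing both foldings of
H_{p-1}(2,1) mod p³ gives H(1,2) + p H(1,3) (`invPairSum_one_two_congr`). -/

open Finset

/-! ### p-integral rationals and congruences between them. -/

/-- The ring of rational numbers whose reduced denominator is prime to `p`. -/
def pIntegers (p : ℕ) [hp : Fact p.Prime] : Subring ℚ where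
  carrier := {x | ¬ p ∣ x.den}
  zero_mem' := by simpa using hp.out.one_lt.ne'
  one_mem' := by simpa using hp.out.one_lt.ne'
  add_mem' {a b} ha hb h :=
    (hp.out.dvd_mul.1 (h.trans (Rat.add_den_dvd a b))).elim ha hb
  mul_mem' {a b} ha hb h :=
    (hp.out.dvd_mul.1 (h.trans (Rat.mul_den_dvd a b))).elim ha hb
  neg_mem' {a} ha := by simpa using ha

section

variable {p : ℕ} [hp : Fact p.Prime]

theorem inv_natCast_mem_pIntegers {k : ℕ} (hk : ¬ p ∣ k) : (k : ℚ)⁻¹ ∈ pIntegers p := by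
  have h0 : k ≠ 0 := by rintro rfl; exact hk (dvd_zero p)
  change ¬ p ∣ ((k : ℚ)⁻¹).den
  rwa [Rat.inv_natCast_den, if_neg h0]

theorem inv_natCast_mem_pIntegers_of_lt {k : ℕ} (h0 : 0 < k) (hk : k < p) :
    (k : ℚ)⁻¹ ∈ pIntegers p :=
  inv_natCast_mem_pIntegers fun h => absurd (Nat.le_of_dvd h0 h) (not_le.2 hk)

theorem natCast_mem_pIntegers (n : ℕ) : (n : ℚ) ∈ pIntegers p := natCast_mem _ n

/-- A rational number with denominator a product of powers of `2`, `3`, `5` is `p`-integral for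
every prime `p > 5`. -/
theorem mem_pIntegers_of_den_dvd (hp5 : 5 < p) (x : ℚ) (h : x.den ∣ 30 ^ 20) :
    x ∈ pIntegers p := by
  intro hx
  have h30 : p ∣ 2 * 3 * 5 := hp.out.dvd_of_dvd_pow (hx.trans h)
  rcases hp.out.dvd_mul.1 h30 with h6 | h5
  · rcases hp.out.dvd_mul.1 h6 with h2 | h3
    · have := Nat.le_of_dvd two_pos h2
      omega
    · have := Nat.le_of_dvd three_pos h3
      omega
  · have := Nat.le_of_dvd (by norm_num) h5
    omega

theorem RatCongr.of_eq {m : ℕ} {x y c : ℚ} (hc : c ∈ pIntegers p)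
    (h : x - y = (p : ℚ) ^ m * c) : RatCongr p m x y := ⟨c, hc, h⟩

/-- Turns a congruence into an equation with an explicit p-integral error, so that relations can be
combined by `linear_combination` and the errors collected in one witness. -/
theorem RatCongr.exists_mem {m : ℕ} {x y : ℚ} (h : RatCongr p m x y) :
    ∃ c ∈ pIntegers p, x = y + (p : ℚ) ^ m * c := by
  obtain ⟨c, hc, h⟩ := h
  exact ⟨c, hc, by linear_combination h⟩

theorem RatCongr.refl (m : ℕ) (x : ℚ) : RatCongr p m x x :=
  .of_eq (zero_mem (pIntegers p)) (by ring)

theorem RatCongr.trans {m : ℕ} {x y z : ℚ} (h : RatCongr p m x y) (h' : RatCongr p m y z) :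
    RatCongr p m x z := by
  obtain ⟨c, hc, h⟩ := h
  obtain ⟨d, hd, h'⟩ := h'
  exact .of_eq (add_mem (S := Subring ℚ) hc hd) (by linear_combination h + h')

theorem RatCongr.add {m : ℕ} {x y x' y' : ℚ} (h : RatCongr p m x y) (h' : RatCongr p m x' y') :
    RatCongr p m (x + x') (y + y') := by
  obtain ⟨c, hc, h⟩ := h
  obtain ⟨d, hd, h'⟩ := h'
  exact .of_eq (add_mem (S := Subring ℚ) hc hd) (by linear_combination h + h')

theorem RatCongr.mul {m : ℕ} {x y x' y' : ℚ} (h : RatCongr p m x y) (h' : RatCongr p m x' y')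
    (hx : x' ∈ pIntegers p) (hy : y ∈ pIntegers p) :
    RatCongr p m (x * x') (y * y') := by
  obtain ⟨c, hc, h⟩ := h
  obtain ⟨d, hd, h'⟩ := h'
  exact .of_eq (c := c * x' + y * d) (add_mem (mul_mem hc hx) (mul_mem hy hd))
    (by linear_combination x' * h + y * h')

theorem RatCongr.sum {ι : Type*} {m : ℕ} {s : Finset ι} {f g : ι → ℚ}
    (h : ∀ i ∈ s, RatCongr p m (f i) (g i)) :
    RatCongr p m (∑ i ∈ s, f i) (∑ i ∈ s, g i) := by
  classical
  induction s using Finset.induction_on with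
  | empty => exact RatCongr.refl _ _
  | insert a s ha ih =>
    rw [sum_insert ha, sum_insert ha]
    exact (h a (mem_insert_self a s)).add (ih fun i hi => h i (mem_insert_of_mem hi))

end

/-! ### Two ways of splitting sums over the nonzero residues -/

theorem sum_Icc_eq_sum_half (h : ℕ) (g : ℕ → ℚ) :
    ∑ k ∈ Icc 1 (2 * h), g k = ∑ k ∈ Icc 1 h, (g k + g (2 * h + 1 - k)) := by
  rw [sum_add_distrib]
  have hs : Icc 1 (2 * h) = Icc 1 h ∪ Icc (h + 1) (2 * h) := by
    ext k; simp only [mem_Icc, mem_union]; omega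
  rw [hs, sum_union (disjoint_left.2 fun k => by simp only [mem_Icc]; omega)]
  congr 1
  refine sum_nbij' (fun k => 2 * h + 1 - k) (fun k => 2 * h + 1 - k) ?_ ?_ ?_ ?_ ?_ <;>
    simp only [mem_Icc] <;> intros <;> try omega
  congr 1
  omega

theorem sum_Icc_eq_sum_parity (h : ℕ) (g : ℕ → ℚ) :
    ∑ k ∈ Icc 1 (2 * h), g k = ∑ k ∈ Icc 1 h, (g (2 * k) + g (2 * h + 1 - 2 * k)) := by
  rw [sum_add_distrib, ← sum_filter_add_sum_filter_not (Icc 1 (2 * h)) Even]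
  congr 1
  · refine sum_nbij' (fun k => k / 2) (fun k => 2 * k) ?_ ?_ ?_ ?_ ?_ <;>
      simp only [mem_filter, mem_Icc, Nat.even_iff] <;> intros <;> try omega
    congr 1
    omega
  · refine sum_nbij' (fun k => (2 * h + 1 - k) / 2) (fun k => 2 * h + 1 - 2 * k)
      ?_ ?_ ?_ ?_ ?_ <;>
      simp only [mem_filter, mem_Icc, Nat.even_iff] <;> intros <;> try omega
    congr 1
    omega

/-- Pairs `i < j` in `{1, …, h}`. -/
def pairsLt (h : ℕ) : Finset (ℕ × ℕ) := (Icc 1 h ×ˢ Icc 1 h).filter fun x => x.1 < x.2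

/-- Pairs of positive integers with sum at most `h`. -/
def pairsSumLe (h : ℕ) : Finset (ℕ × ℕ) := (Icc 1 h ×ˢ Icc 1 h).filter fun x => x.1 + x.2 ≤ h

/-- The cases are: both entries at most h, both above h (reflection reverses their order), and one
on each side, where the inequality is automatic and the whole square appears. -/
theorem sum_pairsLt_eq_sum_half (h : ℕ) (G : ℕ → ℕ → ℚ) :
    ∑ x ∈ pairsLt (2 * h), G x.1 x.2 =
      ∑ x ∈ pairsLt h, G x.1 x.2 + ∑ x ∈ pairsLt h, G (2 * h + 1 - x.2) (2 * h + 1 - x.1) +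
        ∑ x ∈ Icc 1 h ×ˢ Icc 1 h, G x.1 (2 * h + 1 - x.2) := by
  have hsymm : ∑ x ∈ pairsLt h, G (2 * h + 1 - x.2) (2 * h + 1 - x.1) =
      ∑ i ∈ Icc 1 h, ∑ j ∈ Icc 1 h, if j < i then G (2 * h + 1 - i) (2 * h + 1 - j) else 0 := by
    rw [pairsLt, sum_filter, sum_product_right]
  rw [hsymm, pairsLt, pairsLt, sum_filter, sum_filter, sum_product, sum_product, sum_product,
    sum_Icc_eq_sum_half, ← sum_add_distrib, ← sum_add_distrib]
  refine sum_congr rfl fun i hi => ?_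
  rw [sum_Icc_eq_sum_half, sum_Icc_eq_sum_half, ← sum_add_distrib, ← sum_add_distrib,
    ← sum_add_distrib]
  refine sum_congr rfl fun j hj => ?_
  simp only [mem_Icc] at hi hj
  rw [if_pos (by omega : i < 2 * h + 1 - j), if_neg (by omega : ¬ 2 * h + 1 - i < j)]
  have : 2 * h + 1 - i < 2 * h + 1 - j ↔ j < i := by omega
  simp only [this]
  ring

/-- In the mixed cases, 2i < p-2j means i + j ≤ h, and p-2i < 2j is its negation; hence the triangle
in one case and the square minus the triangle in the other. -/
theorem sum_pairsLt_eq_sum_parity (h : ℕ) (G : ℕ → ℕ → ℚ) :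
    ∑ x ∈ pairsLt (2 * h), G x.1 x.2 =
      ∑ x ∈ pairsLt h, G (2 * x.1) (2 * x.2) +
      ∑ x ∈ pairsLt h, G (2 * h + 1 - 2 * x.2) (2 * h + 1 - 2 * x.1) +
      ∑ x ∈ pairsSumLe h, G (2 * x.1) (2 * h + 1 - 2 * x.2) +
      (∑ x ∈ Icc 1 h ×ˢ Icc 1 h, G (2 * h + 1 - 2 * x.1) (2 * x.2) -
        ∑ x ∈ pairsSumLe h, G (2 * h + 1 - 2 * x.1) (2 * x.2)) := by
  have hsymm : ∑ x ∈ pairsLt h, G (2 * h + 1 - 2 * x.2) (2 * h + 1 - 2 * x.1) =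
      ∑ i ∈ Icc 1 h, ∑ j ∈ Icc 1 h,
        if j < i then G (2 * h + 1 - 2 * i) (2 * h + 1 - 2 * j) else 0 := by
    rw [pairsLt, sum_filter, sum_product_right]
  rw [hsymm]
  simp only [pairsLt, pairsSumLe, sum_filter, sum_product]
  rw [sum_Icc_eq_sum_parity, ← sum_sub_distrib, ← sum_add_distrib, ← sum_add_distrib,
    ← sum_add_distrib]
  refine sum_congr rfl fun i hi => ?_
  rw [sum_Icc_eq_sum_parity, sum_Icc_eq_sum_parity, ← sum_sub_distrib, ← sum_add_distrib,
    ← sum_add_distrib, ← sum_add_distrib, ← sum_add_distrib]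
  refine sum_congr rfl fun j hj => ?_
  simp only [mem_Icc] at hi hj
  have h1 : 2 * i < 2 * j ↔ i < j := by omega
  have h2 : 2 * i < 2 * h + 1 - 2 * j ↔ i + j ≤ h := by omega
  have h3 : 2 * h + 1 - 2 * i < 2 * j ↔ ¬ i + j ≤ h := by omega
  have h4 : 2 * h + 1 - 2 * i < 2 * h + 1 - 2 * j ↔ j < i := by omega
  simp only [h1, h2, h3, h4]
  split_ifs <;> first | omega | ring

/-! ### Single sums: the two foldings and their p-adic expansions. -/

/-- The power sum `∑_{k=1}^n k^{-a}`. -/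
def invPowSum (n a : ℕ) : ℚ := ∑ k ∈ Icc 1 n, (k : ℚ)⁻¹ ^ a

theorem inv_sub_eq {p k : ℕ} (h0 : 0 < k) (hk : k < p) :
    ((p - k : ℕ) : ℚ)⁻¹ = -(k : ℚ)⁻¹ + p * (k : ℚ)⁻¹ * ((p - k : ℕ) : ℚ)⁻¹ := by
  have h1 : (k : ℚ) ≠ 0 := by positivity
  have h2 : ((p - k : ℕ) : ℚ) ≠ 0 := by
    have := Nat.sub_pos_of_lt hk
    positivity
  have h3 : (p : ℚ) = k + (p - k : ℕ) := by
    rw [← Nat.cast_add, Nat.add_sub_cancel' hk.le]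
  rw [h3]
  field_simp
  ring

theorem invPowSum_half {p h : ℕ} (hh : p = 2 * h + 1) (a : ℕ) :
    invPowSum (2 * h) a = invPowSum h a + ∑ k ∈ Icc 1 h, ((p - k : ℕ) : ℚ)⁻¹ ^ a := by
  rw [invPowSum, sum_Icc_eq_sum_half, sum_add_distrib, hh, invPowSum]

theorem invPowSum_parity {p h : ℕ} (hh : p = 2 * h + 1) (a : ℕ) :
    invPowSum (2 * h) a = 2⁻¹ ^ a * invPowSum h a
      + ∑ k ∈ Icc 1 h, ((p - 2 * k : ℕ) : ℚ)⁻¹ ^ a := by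
  rw [invPowSum, sum_Icc_eq_sum_parity, sum_add_distrib, hh, invPowSum, mul_sum]
  simp only [Nat.cast_mul, mul_inv, mul_pow, Nat.cast_ofNat]

section

variable {p : ℕ} [hp : Fact p.Prime]

theorem inv_sub_mem {k : ℕ} (h0 : 0 < k) (hk : k < p) :
    ((p - k : ℕ) : ℚ)⁻¹ ∈ pIntegers p :=
  inv_natCast_mem_pIntegers_of_lt (Nat.sub_pos_of_lt hk) (by omega)

theorem inv_sub_congr {k : ℕ} (h0 : 0 < k) (hk : k < p) :
    RatCongr p 5 ((p - k : ℕ) : ℚ)⁻¹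
      (-((k : ℚ)⁻¹ + p * (k : ℚ)⁻¹ ^ 2 + p ^ 2 * (k : ℚ)⁻¹ ^ 3 + p ^ 3 * (k : ℚ)⁻¹ ^ 4
        + p ^ 4 * (k : ℚ)⁻¹ ^ 5)) := by
  have h := inv_sub_eq h0 hk
  have hv := inv_natCast_mem_pIntegers_of_lt h0 hk
  have hw := inv_sub_mem h0 hk
  set v := (k : ℚ)⁻¹
  set w := ((p - k : ℕ) : ℚ)⁻¹
  refine .of_eq (c := v ^ 5 * w) (mul_mem (pow_mem hv _) hw) ?_
  linear_combination (1 + p * v + p ^ 2 * v ^ 2 + p ^ 3 * v ^ 3 + p ^ 4 * v ^ 4) * h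

theorem inv_sub_sq_congr {k : ℕ} (h0 : 0 < k) (hk : k < p) :
    RatCongr p 4 (((p - k : ℕ) : ℚ)⁻¹ ^ 2)
      ((k : ℚ)⁻¹ ^ 2 + 2 * p * (k : ℚ)⁻¹ ^ 3 + 3 * p ^ 2 * (k : ℚ)⁻¹ ^ 4
        + 4 * p ^ 3 * (k : ℚ)⁻¹ ^ 5) := by
  have hv := inv_natCast_mem_pIntegers_of_lt h0 hk
  have hw := inv_sub_mem h0 hk
  have h := inv_sub_eq h0 hk
  set v := (k : ℚ)⁻¹
  set w := ((p - k : ℕ) : ℚ)⁻¹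
  have hpS := natCast_mem_pIntegers (p := p) p
  have h5 := natCast_mem_pIntegers (p := p) 5
  have h4 := natCast_mem_pIntegers (p := p) 4
  -- With x = pv one has w(1-x) = v and (1-x)²(1+2x+3x²+4x³) = 1 - 5x⁴ + 4x⁵; the witness is this
  -- truncation error.
  refine .of_eq (c := w ^ 2 * ((5 : ℕ) * v ^ 4 + -((4 : ℕ) * p * v ^ 5))) ?_ ?_
  · apply_rules [add_mem, mul_mem, pow_mem, neg_mem]
  · push_cast
    linear_combination (1 + 2 * (p * v) + 3 * (p * v) ^ 2 + 4 * (p * v) ^ 3)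
      * (w * (1 - p * v) - v) * h

theorem inv_sub_congr_neg {k : ℕ} (h0 : 0 < k) (hk : k < p) :
    RatCongr p 1 ((p - k : ℕ) : ℚ)⁻¹ (-(k : ℚ)⁻¹) :=
  .of_eq (mul_mem (inv_natCast_mem_pIntegers_of_lt h0 hk) (inv_sub_mem h0 hk))
    (by linear_combination inv_sub_eq h0 hk)

theorem RatCongr.pow {m : ℕ} {x y : ℚ} (h : RatCongr p m x y) (hx : x ∈ pIntegers p)
    (hy : y ∈ pIntegers p) (n : ℕ) : RatCongr p m (x ^ n) (y ^ n) := by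
  induction n with
  | zero => simpa using RatCongr.refl m 1
  | succ n ih => simpa only [pow_succ] using ih.mul h hx (pow_mem hy n)

theorem inv_sub_pow_congr {k : ℕ} (h0 : 0 < k) (hk : k < p) (a : ℕ) :
    RatCongr p 1 (((p - k : ℕ) : ℚ)⁻¹ ^ a) ((-(k : ℚ)⁻¹) ^ a) :=
  (inv_sub_congr_neg h0 hk).pow (inv_sub_mem h0 hk)
    (neg_mem (inv_natCast_mem_pIntegers_of_lt h0 hk)) a

theorem inv_sub_pow_four_congr {k : ℕ} (h0 : 0 < k) (hk : k < p) :
    RatCongr p 2 (((p - k : ℕ) : ℚ)⁻¹ ^ 4) ((k : ℚ)⁻¹ ^ 4 + 4 * p * (k : ℚ)⁻¹ ^ 5) := by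
  have hv := inv_natCast_mem_pIntegers_of_lt h0 hk
  have hw := inv_sub_mem h0 hk
  have h := inv_sub_eq h0 hk
  set v := (k : ℚ)⁻¹
  set w := ((p - k : ℕ) : ℚ)⁻¹
  have hpS := natCast_mem_pIntegers (p := p) p
  have h2 := natCast_mem_pIntegers (p := p) 2
  have h4 := natCast_mem_pIntegers (p := p) 4
  have hsq : w ^ 2 = v ^ 2 - 2 * p * v ^ 2 * w + p ^ 2 * v ^ 2 * w ^ 2 := by
    linear_combination (w + (-v + p * v * w)) * h
  have hsq' : w ^ 2 - (v ^ 2 + (2 : ℕ) * p * v ^ 3) = p ^ 2 * (v ^ 2 * w ^ 2 + -((2 : ℕ) * v ^ 3 * w)) := by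
    push_cast
    linear_combination hsq - 2 * p * v ^ 2 * h
  set e := v ^ 2 * w ^ 2 + -((2 : ℕ) * v ^ 3 * w) with he
  have heS : e ∈ pIntegers p := by rw [he]; apply_rules [add_mem, mul_mem, pow_mem, neg_mem]
  refine .of_eq (c := e * (w ^ 2 + (v ^ 2 + (2 : ℕ) * p * v ^ 3)) + (4 : ℕ) * v ^ 6) ?_ ?_
  · apply_rules [add_mem, mul_mem, pow_mem, neg_mem]
  · push_cast at hsq' ⊢
    linear_combination (w ^ 2 + (v ^ 2 + 2 * p * v ^ 3)) * hsq'

variable {h : ℕ}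

theorem invPowSum_mem {n : ℕ} (hn : n < p) (a : ℕ) : invPowSum n a ∈ pIntegers p :=
  sum_mem fun k hk => by
    simp only [mem_Icc] at hk
    exact pow_mem (inv_natCast_mem_pIntegers_of_lt (by omega) (by omega)) _

/-- Precision p⁵ is needed because this sum is later divided by p. -/
theorem invPowSum_one_half (hh : p = 2 * h + 1) :
    RatCongr p 5 (invPowSum (2 * h) 1)
      (-(p * invPowSum h 2 + p ^ 2 * invPowSum h 3 + p ^ 3 * invPowSum h 4
        + p ^ 4 * invPowSum h 5)) := by
  have h1 := (RatCongr.refl (p := p) 5 (invPowSum h 1)).add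
    (RatCongr.sum (s := Icc 1 h) fun k hk => inv_sub_congr (p := p) (k := k)
      (by simp only [mem_Icc] at hk; omega) (by simp only [mem_Icc] at hk; omega))
  rw [invPowSum_half hh]
  simp only [pow_one]
  convert h1 using 1
  simp only [sum_add_distrib, sum_neg_distrib, ← mul_sum, invPowSum, pow_one]
  ring

theorem invPowSum_two_half (hh : p = 2 * h + 1) :
    RatCongr p 4 (invPowSum (2 * h) 2)
      (2 * invPowSum h 2 + 2 * p * invPowSum h 3 + 3 * p ^ 2 * invPowSum h 4
        + 4 * p ^ 3 * invPowSum h 5) := by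
  have h1 := (RatCongr.refl (p := p) 4 (invPowSum h 2)).add
    (RatCongr.sum (s := Icc 1 h) fun k hk => inv_sub_sq_congr (p := p) (k := k)
      (by simp only [mem_Icc] at hk; omega) (by simp only [mem_Icc] at hk; omega))
  rw [invPowSum_half hh]
  convert h1 using 1
  simp only [sum_add_distrib, ← mul_sum, invPowSum]
  ring

theorem invPowSum_two_parity (hh : p = 2 * h + 1) :
    RatCongr p 4 (invPowSum (2 * h) 2)
      (1 / 2 * invPowSum h 2 + 1 / 4 * p * invPowSum h 3 + 3 / 16 * p ^ 2 * invPowSum h 4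
        + 1 / 8 * p ^ 3 * invPowSum h 5) := by
  have h1 := (RatCongr.refl (p := p) 4 (2⁻¹ ^ 2 * invPowSum h 2)).add
    (RatCongr.sum (s := Icc 1 h) fun k hk => inv_sub_sq_congr (p := p) (k := 2 * k)
      (by simp only [mem_Icc] at hk; omega) (by simp only [mem_Icc] at hk; omega))
  rw [invPowSum_parity hh]
  convert h1 using 1
  simp only [sum_add_distrib, ← mul_sum, invPowSum, Nat.cast_mul, mul_inv, mul_pow,
    Nat.cast_ofNat]
  ring

theorem invPowSum_four_half (hh : p = 2 * h + 1) :
    RatCongr p 2 (invPowSum (2 * h) 4) (2 * invPowSum h 4 + 4 * p * invPowSum h 5) := by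
  have h1 := (RatCongr.refl (p := p) 2 (invPowSum h 4)).add
    (RatCongr.sum (s := Icc 1 h) fun k hk => inv_sub_pow_four_congr (p := p) (k := k)
      (by simp only [mem_Icc] at hk; omega) (by simp only [mem_Icc] at hk; omega))
  rw [invPowSum_half hh]
  convert h1 using 1
  simp only [sum_add_distrib, ← mul_sum, invPowSum]
  ring

theorem invPowSum_four_parity (hh : p = 2 * h + 1) :
    RatCongr p 2 (invPowSum (2 * h) 4)
      (1 / 8 * invPowSum h 4 + 1 / 8 * p * invPowSum h 5) := by
  have h1 := (RatCongr.refl (p := p) 2 (2⁻¹ ^ 4 * invPowSum h 4)).add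
    (RatCongr.sum (s := Icc 1 h) fun k hk => inv_sub_pow_four_congr (p := p) (k := 2 * k)
      (by simp only [mem_Icc] at hk; omega) (by simp only [mem_Icc] at hk; omega))
  rw [invPowSum_parity hh]
  convert h1 using 1
  simp only [sum_add_distrib, ← mul_sum, invPowSum, Nat.cast_mul, mul_inv, mul_pow,
    Nat.cast_ofNat]
  ring

/-- Equating the two foldings gives (15/8) S_4 ≡ -(31/8) p S_5. -/
theorem invPowSum_four_congr (hp5 : 5 < p) (hh : p = 2 * h + 1) :
    RatCongr p 2 (invPowSum h 4) (-(31 / 15) * p * invPowSum h 5) := by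
  obtain ⟨c, hc, h1⟩ := (invPowSum_four_half hh).exists_mem
  obtain ⟨d, hd, h2⟩ := (invPowSum_four_parity hh).exists_mem
  refine .of_eq (c := 8 / 15 * (d - c))
    (mul_mem (mem_pIntegers_of_den_dvd hp5 _ (by norm_num)) (sub_mem hd hc)) ?_
  linear_combination 8 / 15 * (h2 - h1)

end

/-! ### Bernoulli numbers and S_5 modulo p. -/

section

variable {p : ℕ} [hp : Fact p.Prime]

theorem bernoulli'_mem_pIntegers (n : ℕ) (hn : n + 1 < p) : bernoulli' n ∈ pIntegers p := by
  induction n using Nat.strong_induction_on with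
  | _ n ih =>
    rw [bernoulli'_def]
    refine sub_mem (one_mem _) (sum_mem fun k hk => ?_)
    rw [mem_range] at hk
    rw [div_eq_mul_inv]
    have hc : ((n : ℚ) - k + 1) = ((n - k + 1 : ℕ) : ℚ) := by
      rw [Nat.cast_add, Nat.cast_sub hk.le, Nat.cast_one]
    rw [hc]
    exact mul_mem (mul_mem (natCast_mem_pIntegers _)
      (inv_natCast_mem_pIntegers_of_lt (by omega) (by omega))) (ih k hk (by omega))

theorem bernoulli_mem_pIntegers (n : ℕ) (hn : n + 1 < p) : bernoulli n ∈ pIntegers p :=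
  mul_mem (pow_mem (neg_mem (one_mem _)) _) (bernoulli'_mem_pIntegers n hn)

/-- The sum of the `n`-th powers of the residues is `p * B_n` modulo `p ^ 2`. -/
theorem sum_range_pow_congr {n : ℕ} (hn : n + 2 < p) :
    RatCongr p 2 (∑ k ∈ range p, (k : ℚ) ^ n) (p * bernoulli n) := by
  rw [sum_range_pow, sum_range_succ]
  have hn1 : ((n : ℚ) + 1) ≠ 0 := by positivity
  -- In Faulhaber's formula the term i = n is p B_n. Every term i < n carries p^(n+1-i), with
  -- exponent at least 2, and a p-integral coefficient.
  refine .of_eq (c := ∑ i ∈ range n, bernoulli i * ((n + 1).choose i) * (p : ℚ) ^ (n - 1 - i)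
      * ((n + 1 : ℕ) : ℚ)⁻¹) (sum_mem fun i hi => ?_) ?_
  · rw [mem_range] at hi
    exact mul_mem (mul_mem (mul_mem (bernoulli_mem_pIntegers i (by omega))
      (natCast_mem_pIntegers _)) (pow_mem (natCast_mem_pIntegers _) _))
      (inv_natCast_mem_pIntegers_of_lt (by omega) (by omega))
  · have hlast : bernoulli n * ((n + 1).choose n) * (p : ℚ) ^ (n + 1 - n) / (n + 1) =
        p * bernoulli n := by
      rw [Nat.choose_succ_self_right, Nat.add_sub_cancel_left]
      push_cast
      field_simp
    rw [hlast, mul_sum, add_sub_cancel_right]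
    refine sum_congr rfl fun i hi => ?_
    rw [mem_range] at hi
    have : n + 1 - i = 2 + (n - 1 - i) := by omega
    rw [this, pow_add, div_eq_mul_inv]
    push_cast
    ring

theorem pow_sub_congr {k n : ℕ} (hk : k ≤ p) (he : Even n) (h0 : n ≠ 0) :
    RatCongr p 2 (((p - k : ℕ) : ℚ) ^ n) ((k : ℚ) ^ n - n * p * (k : ℚ) ^ (n - 1)) := by
  obtain ⟨c, hc⟩ := Polynomial.powAddExpansion (-(k : ℤ)) (p : ℤ) n
  have hodd : Odd (n - 1) := Nat.Even.sub_odd (Nat.one_le_iff_ne_zero.2 h0) he odd_one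
  rw [he.neg_pow, hodd.neg_pow] at hc
  refine .of_eq (intCast_mem _ c) ?_
  have hc' : (-(k : ℚ) + p) ^ n = (k : ℚ) ^ n + n * -(k : ℚ) ^ (n - 1) * p + c * p ^ 2 := by
    exact_mod_cast hc
  rw [Nat.cast_sub hk, sub_eq_neg_add (p : ℚ) (k : ℚ), hc']
  ring

theorem pow_card_sub_six_congr {k : ℕ} (hp5 : 5 < p) (h0 : 0 < k) (hk : k < p) :
    RatCongr p 1 ((k : ℚ) ^ (p - 6)) ((k : ℚ)⁻¹ ^ 5) := by
  have hkp : ¬ p ∣ k := fun h => absurd (Nat.le_of_dvd h0 h) (not_le.2 hk)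
  have hfer : (k : ℤ) ^ (p - 1) ≡ 1 [ZMOD p] :=
    Int.ModEq.pow_card_sub_one_eq_one hp.out (by
      rw [Nat.isCoprime_iff_coprime]
      exact ((Nat.Prime.coprime_iff_not_dvd hp.out).2 hkp).symm)
  obtain ⟨c, hc⟩ := hfer.symm.dvd
  have hk0 : (k : ℚ) ≠ 0 := by positivity
  refine .of_eq (c := (k : ℚ)⁻¹ ^ 5 * c)
    (mul_mem (pow_mem (inv_natCast_mem_pIntegers_of_lt h0 hk) _) (intCast_mem _ c)) ?_
  have hc' : (k : ℚ) ^ (p - 1) - 1 = p * c := by exact_mod_cast hc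
  have : p - 1 = p - 6 + 5 := by omega
  rw [this, pow_add] at hc'
  have h1 : (k : ℚ)⁻¹ ^ 5 * (k : ℚ) ^ 5 = 1 := by
    rw [← mul_pow, inv_mul_cancel₀ hk0, one_pow]
  linear_combination (k : ℚ)⁻¹ ^ 5 * hc' - (k : ℚ) ^ (p - 6) * h1

variable {h : ℕ}

/-- Here t and u are the half-range sums of k^(p-5) and k^(p-6), with u ≡ S_5 by Fermat. Since
32·2^(p-6) ≡ 1 and p divides t, 16 times the parity folding minus the reflection folding removes t
and leaves 15 p B_{p-5} ≡ -(5/2) p u mod p². -/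
theorem invPowSum_five_congr_bernoulli (hp5 : 5 < p) (hh : p = 2 * h + 1) :
    RatCongr p 1 (invPowSum h 5) (-6 * bernoulli (p - 5)) := by
  have hB : bernoulli (p - 5) ∈ pIntegers p := bernoulli_mem_pIntegers _ (by omega)
  have hp0 : (p : ℚ) ≠ 0 := by exact_mod_cast hp.out.ne_zero
  have hev : Even (p - 5) := ⟨h - 2, by omega⟩
  have hsum : ∑ k ∈ range p, (k : ℚ) ^ (p - 5) = ∑ k ∈ Icc 1 (2 * h), (k : ℚ) ^ (p - 5) := by
    rw [hh, sum_range_eq_add_Ico _ (by omega), ← hh]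
    simp only [Nat.cast_zero, zero_pow (by omega : p - 5 ≠ 0), zero_add]
    exact sum_congr (by ext k; simp only [mem_Ico, mem_Icc]; omega) fun _ _ => rfl
  obtain ⟨d, hd, hS⟩ := (sum_range_pow_congr (p := p) (n := p - 5) (by omega)).exists_mem
  rw [hsum] at hS
  set t := ∑ k ∈ Icc 1 h, (k : ℚ) ^ (p - 5) with ht
  set u := ∑ k ∈ Icc 1 h, (k : ℚ) ^ (p - 6) with hu
  set S := ∑ k ∈ Icc 1 (2 * h), (k : ℚ) ^ (p - 5) with hSdef
  set b := bernoulli (p - 5)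
  have huS : u ∈ pIntegers p := sum_mem fun k _ => pow_mem (natCast_mem_pIntegers k) _
  have h56 : p - 5 - 1 = p - 6 := by omega
  have hn : ((p - 5 : ℕ) : ℚ) = p - 5 := by rw [Nat.cast_sub hp5.le]; rfl
  have hhalf : RatCongr p 2 S (2 * t - (p - 5) * p * u) := by
    have h1 := (RatCongr.refl (p := p) 2 t).add
      (RatCongr.sum (s := Icc 1 h) fun k hk => pow_sub_congr (p := p) (k := k) (n := p - 5)
        (by simp only [mem_Icc] at hk; omega) hev (by omega))
    rw [hSdef, sum_Icc_eq_sum_half, sum_add_distrib, ← hh]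
    convert h1 using 1
    rw [sum_sub_distrib, ← mul_sum, h56, hn]
    ring
  have hpar : RatCongr p 2 S (2 * 2 ^ (p - 5) * t - (p - 5) * p * 2 ^ (p - 6) * u) := by
    have h1 := (RatCongr.refl (p := p) 2 (2 ^ (p - 5) * t)).add
      (RatCongr.sum (s := Icc 1 h) fun k hk => pow_sub_congr (p := p) (k := 2 * k) (n := p - 5)
        (by simp only [mem_Icc] at hk; omega) hev (by omega))
    rw [hSdef, sum_Icc_eq_sum_parity, sum_add_distrib, ← hh]
    convert h1 using 1
    · simp only [ht, Nat.cast_mul, mul_pow, ← mul_sum, Nat.cast_ofNat]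
    · simp only [Nat.cast_mul, mul_pow, Nat.cast_ofNat, h56, hn, sum_sub_distrib, ← mul_sum,
        ← ht, ← hu]
      ring
  have hpow : (2 : ℚ) ^ (p - 5) = 2 * 2 ^ (p - 6) := by
    rw [← pow_succ']
    congr 1
    omega
  have hus : RatCongr p 1 u (invPowSum h 5) := RatCongr.sum fun k hk =>
    pow_card_sub_six_congr hp5 (by simp only [mem_Icc] at hk; omega)
      (by simp only [mem_Icc] at hk; omega)
  obtain ⟨f, hf, hus⟩ := hus.exists_mem
  obtain ⟨c, hc, hhalf⟩ := hhalf.exists_mem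
  obtain ⟨e, he, hpar⟩ := hpar.exists_mem
  obtain ⟨q, hq, h2⟩ := (pow_card_sub_six_congr (p := p) (k := 2) hp5 two_pos
    (by omega)).exists_mem
  have h32 : (32 : ℚ) * 2 ^ (p - 6) = 1 + p * (32 * q) := by
    push_cast at h2
    rw [h2]
    ring
  rw [hpow] at hpar
  have hpS := natCast_mem_pIntegers (p := p) p
  have hmem : ∀ x : ℚ, x.den ∣ 30 ^ 20 → x ∈ pIntegers p := mem_pIntegers_of_den_dvd hp5
  have m1 := hmem (1 / 2) (by norm_num)
  have m2 := hmem 5 (by norm_num)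
  have m3 := hmem 2 (by norm_num)
  have m4 := hmem 32 (by norm_num)
  have m5 := hmem 15 (by norm_num)
  have m6 := hmem 16 (by norm_num)
  have m7 := hmem (2 / 5) (by norm_num)
  clear hmem
  -- τ is t/p, read off from the reflection folding.
  set τ := 1 / 2 * (b + p * d + (p + -5) * u + -(p * c)) with hτdef
  have hτS : τ ∈ pIntegers p := by
    rw [hτdef]
    apply_rules [add_mem, mul_mem, pow_mem, neg_mem]
  have hτ : t = p * τ := by
    rw [hτdef]
    linear_combination 1 / 2 * hS - 1 / 2 * hhalf
  refine .of_eq (c := 2 / 5 * (1 / 2 * u + 2 * (32 * q) * τ + -(1 / 2 * (p + -5) * (32 * q) * u)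
      + 16 * e + -c + -(15 * d)) + -f) ?_ ?_
  · have hr : 32 * q ∈ pIntegers p := mul_mem m4 hq
    refine add_mem (mul_mem m7 ?_) (neg_mem hf)
    apply_rules [add_mem, mul_mem, pow_mem, neg_mem]
  · apply mul_left_cancel₀ hp0
    linear_combination -p * hus - 6 * hS + 2 / 5 * (16 * hpar - hhalf)
      + 2 / 5 * (2 * t - (p - 5) * p * u / 2) * h32 + 2 / 5 * 2 * p * (32 * q) * hτ

end

/-! ### Double sums, Tornheim sums, and weight 5 modulo p. -/

/-- The double sum `∑_{1 ≤ i < j ≤ n} i^{-a} j^{-b}`. -/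
def invPairSum (n a b : ℕ) : ℚ := ∑ x ∈ pairsLt n, (x.1 : ℚ)⁻¹ ^ a * (x.2 : ℚ)⁻¹ ^ b

/-- The Tornheim type sum `∑_{i, j ≥ 1, i + j ≤ n} i^{-a} j^{-b} (i + j)^{-c}`. -/
def tornheimSum (n a b c : ℕ) : ℚ :=
  ∑ x ∈ pairsSumLe n, (x.1 : ℚ)⁻¹ ^ a * (x.2 : ℚ)⁻¹ ^ b * ((x.1 + x.2 : ℕ) : ℚ)⁻¹ ^ c

/-- Partial fractions: 1/(ij) = (1/i + 1/j)/(i+j). Iterating until an exponent vanishes leaves only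
double sums. -/
theorem tornheimSum_succ_succ (n a b c : ℕ) :
    tornheimSum n (a + 1) (b + 1) c =
      tornheimSum n a (b + 1) (c + 1) + tornheimSum n (a + 1) b (c + 1) := by
  rw [tornheimSum, tornheimSum, tornheimSum, ← sum_add_distrib]
  refine sum_congr rfl fun x hx => ?_
  simp only [pairsSumLe, mem_filter, mem_product, mem_Icc] at hx
  have h1 : (x.1 : ℚ) ≠ 0 := by have := hx.1.1.1; positivity
  have h2 : (x.2 : ℚ) ≠ 0 := by have := hx.1.2.1; positivity
  have h3 : ((x.1 + x.2 : ℕ) : ℚ) ≠ 0 := by have := hx.1.2.1; positivity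
  have key : (x.1 : ℚ)⁻¹ * (x.2 : ℚ)⁻¹ =
      ((x.1 + x.2 : ℕ) : ℚ)⁻¹ * ((x.1 : ℚ)⁻¹ + (x.2 : ℚ)⁻¹) := by
    push_cast at h3 ⊢
    field_simp
    ring
  linear_combination (x.1 : ℚ)⁻¹ ^ a * (x.2 : ℚ)⁻¹ ^ b * ((x.1 + x.2 : ℕ) : ℚ)⁻¹ ^ c * key

theorem tornheimSum_zero_left (n b c : ℕ) : tornheimSum n 0 b c = invPairSum n b c := by
  rw [tornheimSum, invPairSum]
  refine sum_nbij' (fun x => (x.2, x.1 + x.2)) (fun x => (x.2 - x.1, x.1)) ?_ ?_ ?_ ?_ ?_ <;>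
    simp only [pairsSumLe, pairsLt, mem_filter, mem_product, mem_Icc, Prod.forall, Prod.mk.injEq,
      pow_zero, one_mul, implies_true, true_and, and_true] <;> omega

theorem tornheimSum_zero_right (n a c : ℕ) : tornheimSum n a 0 c = invPairSum n a c := by
  rw [tornheimSum, invPairSum]
  refine sum_nbij' (fun x => (x.1, x.1 + x.2)) (fun x => (x.1, x.2 - x.1)) ?_ ?_ ?_ ?_ ?_ <;>
    simp only [pairsSumLe, pairsLt, mem_filter, mem_product, mem_Icc, Prod.forall, Prod.mk.injEq,
      pow_zero, mul_one, implies_true, true_and] <;> omega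

/-- The stuffle relation for double sums. -/
theorem invPairSum_add_swap (n a b : ℕ) :
    invPairSum n a b + invPairSum n b a + invPowSum n (a + b) =
      invPowSum n a * invPowSum n b := by
  have hswap : invPairSum n b a = ∑ i ∈ Icc 1 n, ∑ j ∈ Icc 1 n,
      if j < i then (j : ℚ)⁻¹ ^ b * (i : ℚ)⁻¹ ^ a else 0 := by
    rw [invPairSum, pairsLt, sum_filter, sum_product_right]
  have hdiag : invPowSum n (a + b) = ∑ i ∈ Icc 1 n, ∑ j ∈ Icc 1 n,
      if i = j then (i : ℚ)⁻¹ ^ (a + b) else 0 :=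
    sum_congr rfl fun i hi => by rw [sum_ite_eq, if_pos hi]
  rw [hswap, hdiag, invPairSum, pairsLt, sum_filter, sum_product, invPowSum, invPowSum,
    sum_mul_sum, ← sum_add_distrib, ← sum_add_distrib]
  refine sum_congr rfl fun i _ => ?_
  rw [← sum_add_distrib, ← sum_add_distrib]
  refine sum_congr rfl fun j _ => ?_
  rcases lt_trichotomy i j with h | h | h
  · rw [if_pos h, if_neg h.not_gt, if_neg h.ne]
    ring
  · subst h
    simp [pow_add]
  · rw [if_neg h.not_gt, if_pos h, if_neg h.ne']
    ring

section

variable {p : ℕ} [hp : Fact p.Prime] {h : ℕ}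

theorem sum_product_invPow (n a b : ℕ) :
    ∑ x ∈ Icc 1 n ×ˢ Icc 1 n, (x.1 : ℚ)⁻¹ ^ a * (x.2 : ℚ)⁻¹ ^ b =
      invPowSum n a * invPowSum n b := by
  rw [sum_product, invPowSum, invPowSum, sum_mul_sum]

theorem invPairSum_half_congr (hh : p = 2 * h + 1) (a b : ℕ) :
    RatCongr p 1 (invPairSum (2 * h) a b)
      (invPairSum h a b + (-1) ^ (a + b) * invPairSum h b a
        + (-1) ^ b * (invPowSum h a * invPowSum h b)) := by
  rw [invPairSum, sum_pairsLt_eq_sum_half h fun i j => (i : ℚ)⁻¹ ^ a * (j : ℚ)⁻¹ ^ b]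
  refine ((RatCongr.refl _ _).add ?_).add ?_
  · rw [invPairSum, mul_sum]
    refine RatCongr.sum fun x hx => ?_
    simp only [pairsLt, mem_filter, mem_product, mem_Icc] at hx
    rw [← hh]
    convert (inv_sub_pow_congr (p := p) (k := x.2) (by omega) (by omega) a).mul
      (inv_sub_pow_congr (p := p) (k := x.1) (by omega) (by omega) b)
      (pow_mem (inv_sub_mem (by omega) (by omega)) _)
      (pow_mem (neg_mem (inv_natCast_mem_pIntegers_of_lt (by omega) (by omega))) _) using 1
    rw [neg_pow (x.1 : ℚ)⁻¹, neg_pow (x.2 : ℚ)⁻¹]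
    ring
  · rw [← sum_product_invPow, mul_sum]
    refine RatCongr.sum fun x hx => ?_
    simp only [mem_product, mem_Icc] at hx
    rw [← hh]
    convert (RatCongr.refl 1 ((x.1 : ℚ)⁻¹ ^ a)).mul
      (inv_sub_pow_congr (p := p) (k := x.2) (by omega) (by omega) b)
      (pow_mem (inv_sub_mem (by omega) (by omega)) _)
      (pow_mem (inv_natCast_mem_pIntegers_of_lt (by omega) (by omega)) _) using 1
    rw [neg_pow (x.2 : ℚ)⁻¹]
    ring

/-- The Tornheim terms have total coefficient proportional to (-1)^b - (-1)^a, so they cancel in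
even weight but double in odd weight. -/
theorem invPairSum_parity_congr (hh : p = 2 * h + 1) (a b : ℕ) :
    RatCongr p 1 (invPairSum (2 * h) a b)
      (2⁻¹ ^ (a + b) * invPairSum h a b + 2⁻¹ ^ (a + b) * (-1) ^ (a + b) * invPairSum h b a
        + 2⁻¹ ^ (a + b) * (-1) ^ b * tornheimSum h a b 0
        + (2⁻¹ ^ (a + b) * (-1) ^ a * (invPowSum h a * invPowSum h b)
          + -(2⁻¹ ^ (a + b) * (-1) ^ a * tornheimSum h a b 0))) := by
  rw [invPairSum, sum_pairsLt_eq_sum_parity h fun i j => (i : ℚ)⁻¹ ^ a * (j : ℚ)⁻¹ ^ b,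
    sub_eq_add_neg (∑ x ∈ Icc 1 h ×ˢ Icc 1 h, _)]
  have hodd : ∀ x : ℕ × ℕ, 1 ≤ x.1 ∧ x.1 ≤ h → 1 ≤ x.2 ∧ x.2 ≤ h →
      RatCongr p 1 (((2 * h + 1 - 2 * x.1 : ℕ) : ℚ)⁻¹ ^ a * ((2 * x.2 : ℕ) : ℚ)⁻¹ ^ b)
        (2⁻¹ ^ (a + b) * (-1) ^ a * ((x.1 : ℚ)⁻¹ ^ a * (x.2 : ℚ)⁻¹ ^ b)) := by
    intro x h1 h2
    rw [← hh]
    convert (inv_sub_pow_congr (p := p) (k := 2 * x.1) (by omega) (by omega) a).mul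
      (RatCongr.refl 1 (((2 * x.2 : ℕ) : ℚ)⁻¹ ^ b))
      (pow_mem (inv_natCast_mem_pIntegers_of_lt (by omega) (by omega)) _)
      (pow_mem (neg_mem (inv_natCast_mem_pIntegers_of_lt (by omega) (by omega))) _) using 1
    rw [neg_pow ((2 * x.1 : ℕ) : ℚ)⁻¹]
    push_cast
    rw [mul_inv, mul_inv]
    ring
  refine (((RatCongr.of_eq (zero_mem _) ?_).add ?_).add ?_).add (.add ?_ ?_)
  · rw [invPairSum, mul_sum, mul_zero, ← sum_sub_distrib]
    refine sum_eq_zero fun x _ => ?_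
    push_cast
    rw [mul_inv, mul_inv]
    ring
  · rw [invPairSum, mul_sum]
    refine RatCongr.sum fun x hx => ?_
    simp only [pairsLt, mem_filter, mem_product, mem_Icc] at hx
    rw [← hh]
    convert (inv_sub_pow_congr (p := p) (k := 2 * x.2) (by omega) (by omega) a).mul
      (inv_sub_pow_congr (p := p) (k := 2 * x.1) (by omega) (by omega) b)
      (pow_mem (inv_sub_mem (by omega) (by omega)) _)
      (pow_mem (neg_mem (inv_natCast_mem_pIntegers_of_lt (by omega) (by omega))) _) using 1
    rw [neg_pow ((2 * x.1 : ℕ) : ℚ)⁻¹, neg_pow ((2 * x.2 : ℕ) : ℚ)⁻¹]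
    push_cast
    rw [mul_inv, mul_inv]
    ring
  · rw [tornheimSum, mul_sum]
    refine RatCongr.sum fun x hx => ?_
    simp only [pairsSumLe, mem_filter, mem_product, mem_Icc] at hx
    rw [← hh]
    convert (RatCongr.refl 1 (((2 * x.1 : ℕ) : ℚ)⁻¹ ^ a)).mul
      (inv_sub_pow_congr (p := p) (k := 2 * x.2) (by omega) (by omega) b)
      (pow_mem (inv_sub_mem (by omega) (by omega)) _)
      (pow_mem (inv_natCast_mem_pIntegers_of_lt (by omega) (by omega)) _) using 1
    rw [neg_pow ((2 * x.2 : ℕ) : ℚ)⁻¹]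
    push_cast
    rw [mul_inv, mul_inv]
    ring
  · rw [← sum_product_invPow, mul_sum]
    refine RatCongr.sum fun x hx => ?_
    simp only [mem_product, mem_Icc] at hx
    exact hodd x hx.1 hx.2
  · rw [tornheimSum, mul_sum, ← sum_neg_distrib, ← sum_neg_distrib]
    refine RatCongr.sum fun x hx => ?_
    simp only [pairsSumLe, mem_filter, mem_product, mem_Icc] at hx
    obtain ⟨c, hc, hx⟩ := hodd x hx.1.1 hx.1.2
    exact .of_eq (neg_mem (S := Subring ℚ) hc) (by linear_combination -hx)

/-- Modulo p the foldings read 2 S_2 and S_2/2. -/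
theorem invPowSum_two_dvd (hp5 : 5 < p) (hh : p = 2 * h + 1) :
    RatCongr p 1 (invPowSum h 2) 0 := by
  obtain ⟨c, hc, h1⟩ := (invPowSum_two_half hh).exists_mem
  obtain ⟨d, hd, h2⟩ := (invPowSum_two_parity hh).exists_mem
  have hs : ∀ a, invPowSum h a ∈ pIntegers p := invPowSum_mem (by omega)
  have hpS := natCast_mem_pIntegers (p := p) p
  have m1 := mem_pIntegers_of_den_dvd hp5 (2 / 3) (by norm_num)
  have m2 := mem_pIntegers_of_den_dvd hp5 (7 / 4) (by norm_num)
  have m3 := mem_pIntegers_of_den_dvd hp5 (45 / 16) (by norm_num)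
  have m4 := mem_pIntegers_of_den_dvd hp5 (31 / 8) (by norm_num)
  have hs3 := hs 3
  have hs4 := hs 4
  have hs5 := hs 5
  refine .of_eq (c := 2 / 3 * (p ^ 3 * (d - c) - 7 / 4 * invPowSum h 3
    - 45 / 16 * p * invPowSum h 4 - 31 / 8 * p ^ 2 * invPowSum h 5)) ?_ ?_
  · clear hs
    apply_rules [sub_mem, add_mem, mul_mem, pow_mem, neg_mem]
  · linear_combination 2 / 3 * (h2 - h1)

theorem invPairSum_one_four_congr (hp5 : 5 < p) (hh : p = 2 * h + 1) :
    RatCongr p 1 (invPairSum h 1 4) (-(7 / 12) * invPowSum h 5) := by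
  obtain ⟨c, hc, h1⟩ := (invPairSum_half_congr hh 1 4).exists_mem
  obtain ⟨d, hd, h2⟩ := (invPairSum_parity_congr hh 1 4).exists_mem
  obtain ⟨e, he, h3⟩ := (invPowSum_two_dvd hp5 hh).exists_mem
  have hs3 : invPowSum h 3 ∈ pIntegers p := invPowSum_mem (by omega) 3
  have h14 := invPairSum_add_swap h 1 4
  have h23 := invPairSum_add_swap h 2 3
  -- The Tornheim sum becomes H(4,1) + H(3,2) + H(2,3) + 2H(1,4). As H(2,3) and H(3,2) enter only
  -- through their sum, the stuffle relation removes them.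
  simp only [tornheimSum_succ_succ, tornheimSum_zero_left, tornheimSum_zero_right] at h2
  norm_num at h1 h2 h14 h23
  have m1 := mem_pIntegers_of_den_dvd hp5 (1 / 30) (by norm_num)
  have m2 := mem_pIntegers_of_den_dvd hp5 (8 / 15) (by norm_num)
  refine .of_eq (c := 1 / 30 * (e * invPowSum h 3) - 8 / 15 * (c - d)) ?_ ?_
  · apply_rules [sub_mem, add_mem, mul_mem, pow_mem, neg_mem]
  · linear_combination 8 / 15 * (h2 - h1) + 11 / 20 * h14 + 1 / 30 * h23
      + 1 / 30 * invPowSum h 3 * h3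

theorem invPairSum_two_three_congr_eleven :
    RatCongr 11 1 (invPairSum 5 2 3) (-(1 / 3) * invPowSum 5 5) := by
  have hI : Icc 1 5 = ({1, 2, 3, 4, 5} : Finset ℕ) := rfl
  refine ⟨(invPairSum 5 2 3 + 1 / 3 * invPowSum 5 5) / 11, ?_, by ring⟩
  rw [invPairSum, pairsLt, sum_filter, sum_product, invPowSum, hI]
  norm_num

theorem invPairSum_two_three_congr (hp5 : 5 < p) (hh : p = 2 * h + 1) :
    RatCongr p 1 (invPairSum h 2 3) (-(1 / 3) * invPowSum h 5) := by
  -- After elimination the relation is 66 H(2,3) ≡ -22 S_5, which is void for p = 11; that prime is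
  -- checked directly.
  by_cases h11 : p = 11
  · obtain rfl : h = 5 := by omega
    subst h11
    exact invPairSum_two_three_congr_eleven
  have h11' : ((11 : ℕ) : ℚ)⁻¹ ∈ pIntegers p := inv_natCast_mem_pIntegers fun hd =>
    h11 ((Nat.prime_dvd_prime_iff_eq hp.out (by norm_num)).1 hd)
  obtain ⟨c, hc, h1⟩ := (invPairSum_half_congr hh 2 3).exists_mem
  obtain ⟨d, hd, h2⟩ := (invPairSum_parity_congr hh 2 3).exists_mem
  obtain ⟨e, he, h3⟩ := (invPowSum_two_dvd hp5 hh).exists_mem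
  obtain ⟨g, hg, h4⟩ := (invPairSum_one_four_congr hp5 hh).exists_mem
  have hs3 : invPowSum h 3 ∈ pIntegers p := invPowSum_mem (by omega) 3
  have h23 := invPairSum_add_swap h 2 3
  simp only [tornheimSum_succ_succ, tornheimSum_zero_left, tornheimSum_zero_right] at h2
  norm_num at h1 h2 h23
  have m1 := mem_pIntegers_of_den_dvd hp5 (1 / 6) (by norm_num)
  have m2 := mem_pIntegers_of_den_dvd hp5 62 (by norm_num)
  have m3 := mem_pIntegers_of_den_dvd hp5 32 (by norm_num)
  have m4 := mem_pIntegers_of_den_dvd hp5 12 (by norm_num)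
  refine .of_eq (c := 1 / 6 * ((11 : ℕ) : ℚ)⁻¹ * (62 * (e * invPowSum h 3) - 12 * g - 32 * (c - d)))
    ?_ ?_
  · apply_rules [sub_mem, add_mem, mul_mem, pow_mem, neg_mem]
  · push_cast
    linear_combination 1 / 66 * (32 * (h2 - h1) + 29 * h23
      + 62 * invPowSum h 3 * h3 - 12 * h4)

end

/-! ### The weight 3 double sum modulo p³. -/

section

variable {p : ℕ} [hp : Fact p.Prime] {h : ℕ}

theorem inv_sub_congr_cubed {k : ℕ} (h0 : 0 < k) (hk : k < p) :
    RatCongr p 3 ((p - k : ℕ) : ℚ)⁻¹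
      (-((k : ℚ)⁻¹ + p * (k : ℚ)⁻¹ ^ 2 + p ^ 2 * (k : ℚ)⁻¹ ^ 3)) :=
  .of_eq (mul_mem (pow_mem (inv_natCast_mem_pIntegers_of_lt h0 hk) 3) (inv_sub_mem h0 hk))
    (by linear_combination (1 + p * (k : ℚ)⁻¹ + p ^ 2 * (k : ℚ)⁻¹ ^ 2) * inv_sub_eq h0 hk)

theorem inv_sub_sq_congr_cubed {k : ℕ} (h0 : 0 < k) (hk : k < p) :
    RatCongr p 3 (((p - k : ℕ) : ℚ)⁻¹ ^ 2)
      ((k : ℚ)⁻¹ ^ 2 + 2 * p * (k : ℚ)⁻¹ ^ 3 + 3 * p ^ 2 * (k : ℚ)⁻¹ ^ 4) := by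
  obtain ⟨c, hc, h⟩ := (inv_sub_sq_congr h0 hk).exists_mem
  have hv := inv_natCast_mem_pIntegers_of_lt h0 hk
  exact .of_eq (c := p * c + (4 : ℕ) * (k : ℚ)⁻¹ ^ 5)
    (add_mem (mul_mem (natCast_mem_pIntegers p) hc)
      (mul_mem (natCast_mem_pIntegers 4) (pow_mem hv _)))
    (by push_cast; linear_combination h)

theorem inv_sub_sq_mul_inv_sub_congr {k l : ℕ} (hk0 : 0 < k) (hk : k < p) (hl0 : 0 < l)
    (hl : l < p) :
    RatCongr p 3 (((p - l : ℕ) : ℚ)⁻¹ ^ 2 * ((p - k : ℕ) : ℚ)⁻¹)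
      (-((k : ℚ)⁻¹ ^ 1 * (l : ℚ)⁻¹ ^ 2 + 2 * p * ((k : ℚ)⁻¹ ^ 1 * (l : ℚ)⁻¹ ^ 3)
        + p * ((k : ℚ)⁻¹ ^ 2 * (l : ℚ)⁻¹ ^ 2) + 3 * p ^ 2 * ((k : ℚ)⁻¹ ^ 1 * (l : ℚ)⁻¹ ^ 4)
        + 2 * p ^ 2 * ((k : ℚ)⁻¹ ^ 2 * (l : ℚ)⁻¹ ^ 3)
        + p ^ 2 * ((k : ℚ)⁻¹ ^ 3 * (l : ℚ)⁻¹ ^ 2))) := by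
  have hv := inv_natCast_mem_pIntegers_of_lt hk0 hk
  have hw := inv_natCast_mem_pIntegers_of_lt hl0 hl
  have hpS := natCast_mem_pIntegers (p := p) p
  have n2 := natCast_mem_pIntegers (p := p) 2
  have n3 := natCast_mem_pIntegers (p := p) 3
  refine ((inv_sub_sq_congr_cubed hl0 hl).mul (inv_sub_congr_cubed hk0 hk)
    (inv_sub_mem hk0 hk) ?_).trans ?_
  · exact_mod_cast add_mem (add_mem (pow_mem hw 2) (mul_mem (mul_mem n2 hpS) (pow_mem hw 3)))
      (mul_mem (mul_mem n3 (pow_mem hpS 2)) (pow_mem hw 4))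
  · set v := (k : ℚ)⁻¹
    set w := (l : ℚ)⁻¹
    refine .of_eq (c := -((2 : ℕ) * (v ^ 3 * w ^ 3) + (3 : ℕ) * (v ^ 2 * w ^ 4)
      + (3 : ℕ) * p * (v ^ 3 * w ^ 4))) ?_ ?_
    · apply_rules [add_mem, mul_mem, pow_mem, neg_mem]
    · push_cast
      ring

theorem invPairSum_two_one_half (hh : p = 2 * h + 1) :
    RatCongr p 3 (invPairSum (2 * h) 2 1)
      (invPairSum h 2 1
        + -(invPairSum h 1 2 + 2 * p * invPairSum h 1 3 + p * invPairSum h 2 2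
          + 3 * p ^ 2 * invPairSum h 1 4 + 2 * p ^ 2 * invPairSum h 2 3
          + p ^ 2 * invPairSum h 3 2)
        + -(invPowSum h 2 * invPowSum h 1 + p * (invPowSum h 2 * invPowSum h 2)
          + p ^ 2 * (invPowSum h 2 * invPowSum h 3))) := by
  rw [invPairSum, sum_pairsLt_eq_sum_half h fun i j => (i : ℚ)⁻¹ ^ 2 * (j : ℚ)⁻¹ ^ 1]
  refine ((RatCongr.refl _ _).add ?_).add ?_
  · simp only [invPairSum, mul_sum, ← sum_add_distrib, ← sum_neg_distrib]
    refine RatCongr.sum fun x hx => ?_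
    simp only [pairsLt, mem_filter, mem_product, mem_Icc] at hx
    rw [← hh, pow_one ((p - x.1 : ℕ) : ℚ)⁻¹]
    exact inv_sub_sq_mul_inv_sub_congr (by omega) (by omega) (by omega) (by omega)
  · simp only [← sum_product_invPow, mul_sum, ← sum_add_distrib, ← sum_neg_distrib]
    refine RatCongr.sum fun x hx => ?_
    simp only [mem_product, mem_Icc] at hx
    rw [← hh]
    convert (RatCongr.refl 3 ((x.1 : ℚ)⁻¹ ^ 2)).mul
      (inv_sub_congr_cubed (p := p) (k := x.2) (by omega) (by omega))
      (inv_sub_mem (by omega) (by omega))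
      (pow_mem (inv_natCast_mem_pIntegers_of_lt (by omega) (by omega)) _) using 1 <;> ring

theorem inv_sub_sq_mul_inv_congr {i j : ℕ} (hi0 : 0 < i) (hi : 2 * i < p) (hj0 : 0 < j)
    (hj : 2 * j < p) :
    RatCongr p 3 (((p - 2 * i : ℕ) : ℚ)⁻¹ ^ 2 * ((2 * j : ℕ) : ℚ)⁻¹ ^ 1)
      (1 / 8 * ((i : ℚ)⁻¹ ^ 2 * (j : ℚ)⁻¹ ^ 1) + 1 / 8 * p * ((i : ℚ)⁻¹ ^ 3 * (j : ℚ)⁻¹ ^ 1)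
        + 3 / 32 * p ^ 2 * ((i : ℚ)⁻¹ ^ 4 * (j : ℚ)⁻¹ ^ 1)) := by
  have hv := inv_natCast_mem_pIntegers_of_lt (p := p) (k := 2 * i) (by omega) (by omega)
  have hpS := natCast_mem_pIntegers (p := p) p
  have n2 := natCast_mem_pIntegers (p := p) 2
  have n3 := natCast_mem_pIntegers (p := p) 3
  convert (inv_sub_sq_congr_cubed (p := p) (k := 2 * i) (by omega) (by omega)).mul
      (RatCongr.refl 3 (((2 * j : ℕ) : ℚ)⁻¹ ^ 1))
      (pow_mem (inv_natCast_mem_pIntegers_of_lt (by omega) (by omega)) _) ?_ using 1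
  · push_cast
    rw [mul_inv, mul_inv]
    ring
  · exact_mod_cast add_mem (add_mem (pow_mem hv 2) (mul_mem (mul_mem n2 hpS) (pow_mem hv 3)))
      (mul_mem (mul_mem n3 (pow_mem hpS 2)) (pow_mem hv 4))

theorem invPairSum_two_one_parity (hh : p = 2 * h + 1) :
    RatCongr p 3 (invPairSum (2 * h) 2 1)
      (1 / 8 * invPairSum h 2 1
        + -(1 / 8 * invPairSum h 1 2 + 1 / 8 * p * invPairSum h 1 3
          + 1 / 16 * p * invPairSum h 2 2 + 3 / 32 * p ^ 2 * invPairSum h 1 4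
          + 1 / 16 * p ^ 2 * invPairSum h 2 3 + 1 / 32 * p ^ 2 * invPairSum h 3 2)
        + -(1 / 8 * tornheimSum h 2 1 0 + 1 / 16 * p * tornheimSum h 2 2 0
          + 1 / 32 * p ^ 2 * tornheimSum h 2 3 0)
        + ((1 / 8 * (invPowSum h 2 * invPowSum h 1) + 1 / 8 * p * (invPowSum h 3 * invPowSum h 1)
            + 3 / 32 * p ^ 2 * (invPowSum h 4 * invPowSum h 1))
          + -(1 / 8 * tornheimSum h 2 1 0 + 1 / 8 * p * tornheimSum h 3 1 0
            + 3 / 32 * p ^ 2 * tornheimSum h 4 1 0))) := by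
  rw [invPairSum, sum_pairsLt_eq_sum_parity h fun i j => (i : ℚ)⁻¹ ^ 2 * (j : ℚ)⁻¹ ^ 1,
    sub_eq_add_neg (∑ x ∈ Icc 1 h ×ˢ Icc 1 h, _)]
  refine (((RatCongr.of_eq (zero_mem _) ?_).add ?_).add ?_).add (.add ?_ ?_)
  · rw [invPairSum, mul_sum, mul_zero, ← sum_sub_distrib]
    refine sum_eq_zero fun x _ => ?_
    push_cast
    rw [mul_inv, mul_inv]
    ring
  · simp only [invPairSum, mul_sum, ← sum_add_distrib, ← sum_neg_distrib]
    refine RatCongr.sum fun x hx => ?_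
    simp only [pairsLt, mem_filter, mem_product, mem_Icc] at hx
    rw [← hh, pow_one ((p - 2 * x.1 : ℕ) : ℚ)⁻¹]
    convert inv_sub_sq_mul_inv_sub_congr (p := p) (k := 2 * x.1) (l := 2 * x.2)
      (by omega) (by omega) (by omega) (by omega) using 1
    push_cast
    rw [mul_inv, mul_inv]
    ring
  · simp only [tornheimSum, mul_sum, ← sum_add_distrib, ← sum_neg_distrib]
    refine RatCongr.sum fun x hx => ?_
    simp only [pairsSumLe, mem_filter, mem_product, mem_Icc] at hx
    rw [← hh]
    convert (RatCongr.refl 3 (((2 * x.1 : ℕ) : ℚ)⁻¹ ^ 2)).mul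
      (inv_sub_congr_cubed (p := p) (k := 2 * x.2) (by omega) (by omega))
      (inv_sub_mem (by omega) (by omega))
      (pow_mem (inv_natCast_mem_pIntegers_of_lt (by omega) (by omega)) _) using 1
    · ring
    · push_cast
      rw [mul_inv, mul_inv]
      ring
  · simp only [← sum_product_invPow, mul_sum, ← sum_add_distrib]
    refine RatCongr.sum fun x hx => ?_
    simp only [mem_product, mem_Icc] at hx
    rw [← hh]
    exact inv_sub_sq_mul_inv_congr (by omega) (by omega) (by omega) (by omega)
  · simp only [tornheimSum, mul_sum, ← sum_add_distrib, ← sum_neg_distrib]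
    refine RatCongr.sum fun x hx => ?_
    simp only [pairsSumLe, mem_filter, mem_product, mem_Icc] at hx
    rw [← hh]
    obtain ⟨c, hc, hx⟩ := inv_sub_sq_mul_inv_congr (p := p) (i := x.1) (j := x.2)
      (by omega) (by omega) (by omega) (by omega)
    exact .of_eq (neg_mem (S := Subring ℚ) hc) (by linear_combination -hx)

/-- After the stuffle relations, H(1,2) and p H(1,3) both have coefficient -2 in one folding and
-1/2 in the other, so only H(1,2) + p H(1,3) is determined. All products with S_1 cancel, H(2,2)
reduces to S_2² and S_4, and the p² terms need weight 5 only modulo p. -/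
theorem invPairSum_one_two_congr (hp5 : 5 < p) (hh : p = 2 * h + 1) :
    RatCongr p 3 (invPairSum h 1 2 + p * invPairSum h 1 3)
      (-(3 / 4) * invPowSum h 3 + 341 / 240 * p ^ 2 * invPowSum h 5) := by
  obtain ⟨c, hc, h1⟩ := (invPairSum_two_one_half hh).exists_mem
  obtain ⟨d, hd, h2⟩ := (invPairSum_two_one_parity hh).exists_mem
  obtain ⟨e, he, h3⟩ := (invPowSum_two_dvd hp5 hh).exists_mem
  obtain ⟨f, hf, h4⟩ := (invPowSum_four_congr hp5 hh).exists_mem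
  obtain ⟨g, hg, h14⟩ := (invPairSum_one_four_congr hp5 hh).exists_mem
  obtain ⟨k, hk, h23⟩ := (invPairSum_two_three_congr hp5 hh).exists_mem
  have hs3 : invPowSum h 3 ∈ pIntegers p := invPowSum_mem (by omega) 3
  have e12 := invPairSum_add_swap h 1 2
  have e13 := invPairSum_add_swap h 1 3
  have e22 := invPairSum_add_swap h 2 2
  have e14 := invPairSum_add_swap h 1 4
  have e23 := invPairSum_add_swap h 2 3
  simp only [tornheimSum_succ_succ, tornheimSum_zero_left, tornheimSum_zero_right] at h2
  norm_num at h1 h2 h3 h4 h14 h23 e12 e13 e22 e14 e23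
  have m1 := mem_pIntegers_of_den_dvd hp5 (2 / 3) (by norm_num)
  have m2 := mem_pIntegers_of_den_dvd hp5 (7 / 4) (by norm_num)
  have m3 := mem_pIntegers_of_den_dvd hp5 (29 / 48) (by norm_num)
  have m4 := mem_pIntegers_of_den_dvd hp5 (59 / 48) (by norm_num)
  have m5 := mem_pIntegers_of_den_dvd hp5 (43 / 48) (by norm_num)
  have m6 := mem_pIntegers_of_den_dvd hp5 (7 / 48) (by norm_num)
  refine .of_eq (c := 2 / 3 * (c - d) - 7 / 4 * g - 29 / 48 * k - 59 / 48 * (e * invPowSum h 3)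
    - 43 / 48 * e ^ 2 + 7 / 48 * f) ?_ ?_
  · apply_rules [sub_mem, add_mem, mul_mem, pow_mem, neg_mem]
  · linear_combination 2 / 3 * (h1 - h2) + 3 / 4 * e12 + 1 / 12 * p * e13 - 11 / 48 * p * e22
      + 1 / 16 * p ^ 2 * e14 - 9 / 16 * p ^ 2 * e23 - 7 / 4 * p ^ 2 * h14
      - 29 / 48 * p ^ 2 * h23 - 59 / 48 * p ^ 2 * invPowSum h 3 * h3
      - 43 / 48 * p * (invPowSum h 2 + p * e) * h3 + 7 / 48 * p * h4

end

/-! ### Translation to multiple harmonic sums and the final combinations. -/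

theorem multipleHarmonicSum_one (n a : ℕ) : multipleHarmonicSum n ![a] = invPowSum n a := by
  rw [multipleHarmonicSum, invPowSum]
  refine sum_nbij' (fun k => k 0) (fun k _ => k) ?_ ?_ ?_ ?_ ?_
  · intro k hk
    exact Fintype.mem_piFinset.1 (mem_filter.1 hk).1 0
  · intro k hk
    refine mem_filter.2 ⟨Fintype.mem_piFinset.2 fun _ => hk, fun i j hij => ?_⟩
    exact absurd hij (by simp [Subsingleton.elim i j])
  · intro k _
    funext i
    rw [Subsingleton.elim i 0]
  · intro k _
    rfl
  · intro k _
    simp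

theorem multipleHarmonicSum_two (n a b : ℕ) :
    multipleHarmonicSum n ![a, b] = invPairSum n a b := by
  rw [multipleHarmonicSum, invPairSum]
  refine sum_nbij' (fun k => (k 0, k 1)) (fun x => ![x.1, x.2]) ?_ ?_ ?_ ?_ ?_
  · intro k hk
    obtain ⟨hk, hlt⟩ := mem_filter.1 hk
    rw [Fintype.mem_piFinset] at hk
    exact mem_filter.2 ⟨mem_product.2 ⟨hk 0, hk 1⟩, hlt 0 1 Fin.zero_lt_one⟩
  · intro x hx
    obtain ⟨hx, hlt⟩ := mem_filter.1 hx
    rw [mem_product] at hx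
    refine mem_filter.2 ⟨Fintype.mem_piFinset.2 (Fin.forall_fin_two.2 hx), ?_⟩
    simpa [Fin.forall_fin_two] using hlt
  · intro k _
    funext i
    fin_cases i <;> rfl
  · intro x _
    rfl
  · intro k _
    simp [mul_comm]

section

variable {p : ℕ} [hp : Fact p.Prime] {h : ℕ}

theorem invPowSum_one_div (hh : p = 2 * h + 1) :
    RatCongr p 4 (invPowSum (2 * h) 1 / p)
      (-(invPowSum h 2 + p * invPowSum h 3 + p ^ 2 * invPowSum h 4
        + p ^ 3 * invPowSum h 5)) := by
  obtain ⟨c, hc, h1⟩ := (invPowSum_one_half hh).exists_mem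
  have hp0 : (p : ℚ) ≠ 0 := by exact_mod_cast hp.out.ne_zero
  refine .of_eq hc ?_
  rw [h1]
  field_simp
  ring

/-- Adding 2 H_{p-1}(1)/p cancels S_2 and S_3, leaving p² S_4 + 2p³ S_5 ≡ -(1/15) p³ S_5. -/
theorem invPowSum_two_full_congr (hp5 : 5 < p) (hh : p = 2 * h + 1) :
    RatCongr p 4 (invPowSum (2 * h) 2)
      (-2 * (invPowSum (2 * h) 1 / p) + 2 / 5 * p ^ 3 * bernoulli (p - 5)) := by
  obtain ⟨c, hc, h1⟩ := (invPowSum_one_div hh).exists_mem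
  obtain ⟨d, hd, h2⟩ := (invPowSum_two_half hh).exists_mem
  obtain ⟨f, hf, h4⟩ := (invPowSum_four_congr hp5 hh).exists_mem
  obtain ⟨b, hb, h5⟩ := (invPowSum_five_congr_bernoulli hp5 hh).exists_mem
  have m1 := mem_pIntegers_of_den_dvd hp5 2 (by norm_num)
  have m2 := mem_pIntegers_of_den_dvd hp5 (1 / 15) (by norm_num)
  refine .of_eq (c := d + 2 * c + f - 1 / 15 * b) ?_ ?_
  · apply_rules [sub_mem, add_mem, mul_mem, pow_mem, neg_mem]
  · linear_combination h2 + 2 * h1 + p ^ 2 * h4 - 1 / 15 * p ^ 3 * h5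

/-- Four times the parity folding minus the reflection folding eliminates S_2 and isolates p S_3;
the factor p is why the final congruence for S_3 holds only modulo p³. -/
theorem invPowSum_three_congr_mul (hp5 : 5 < p) (hh : p = 2 * h + 1) :
    RatCongr p 4 (p * invPowSum h 3)
      (6 * (invPowSum (2 * h) 1 / p) - 81 / 10 * p ^ 3 * bernoulli (p - 5)) := by
  obtain ⟨c, hc, h1⟩ := (invPowSum_two_full_congr hp5 hh).exists_mem
  obtain ⟨d, hd, h2⟩ := (invPowSum_two_half hh).exists_mem
  obtain ⟨e, he, h3⟩ := (invPowSum_two_parity hh).exists_mem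
  obtain ⟨f, hf, h4⟩ := (invPowSum_four_congr hp5 hh).exists_mem
  obtain ⟨b, hb, h5⟩ := (invPowSum_five_congr_bernoulli hp5 hh).exists_mem
  have m1 := mem_pIntegers_of_den_dvd hp5 4 (by norm_num)
  have m2 := mem_pIntegers_of_den_dvd hp5 3 (by norm_num)
  have m3 := mem_pIntegers_of_den_dvd hp5 (9 / 4) (by norm_num)
  have m4 := mem_pIntegers_of_den_dvd hp5 (23 / 20) (by norm_num)
  refine .of_eq (c := 4 * e - d - 3 * c - 9 / 4 * f + 23 / 20 * b) ?_ ?_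
  · apply_rules [sub_mem, add_mem, mul_mem, pow_mem, neg_mem]
  · linear_combination 4 * h3 - h2 - 3 * h1 - 9 / 4 * p ^ 2 * h4 + 23 / 20 * p ^ 3 * h5

theorem invPowSum_two_congr (hp5 : 5 < p) (hh : p = 2 * h + 1) :
    RatCongr p 4 (invPowSum h 2)
      (-7 * (invPowSum (2 * h) 1 / p) + 17 / 10 * p ^ 3 * bernoulli (p - 5)) := by
  obtain ⟨c, hc, h1⟩ := (invPowSum_one_div hh).exists_mem
  obtain ⟨d, hd, h2⟩ := (invPowSum_three_congr_mul hp5 hh).exists_mem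
  obtain ⟨f, hf, h4⟩ := (invPowSum_four_congr hp5 hh).exists_mem
  obtain ⟨b, hb, h5⟩ := (invPowSum_five_congr_bernoulli hp5 hh).exists_mem
  have m1 := mem_pIntegers_of_den_dvd hp5 (16 / 15) (by norm_num)
  refine .of_eq (c := c - d - f + 16 / 15 * b) ?_ ?_
  · apply_rules [sub_mem, add_mem, mul_mem, pow_mem, neg_mem]
  · linear_combination h1 - h2 - p ^ 2 * h4 + 16 / 15 * p ^ 3 * h5

theorem invPowSum_three_congr (hp5 : 5 < p) (hh : p = 2 * h + 1) :
    RatCongr p 3 (invPowSum h 3)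
      (6 * (invPowSum (2 * h) 1 / p ^ 2) - 81 / 10 * p ^ 2 * bernoulli (p - 5)) := by
  obtain ⟨c, hc, h1⟩ := invPowSum_three_congr_mul hp5 hh
  have hp0 : (p : ℚ) ≠ 0 := by exact_mod_cast hp.out.ne_zero
  refine .of_eq hc (mul_left_cancel₀ hp0 ?_)
  have h2 : (p : ℚ) * (invPowSum (2 * h) 1 / p ^ 2) = invPowSum (2 * h) 1 / p := by
    field_simp
  linear_combination h1 - 6 * h2

theorem invPairSum_congr (hp5 : 5 < p) (hh : p = 2 * h + 1) :
    RatCongr p 3 (invPairSum h 1 2 + p * invPairSum h 1 3)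
      (-(9 / 2) * (invPowSum (2 * h) 1 / p ^ 2) - 49 / 20 * p ^ 2 * bernoulli (p - 5)) := by
  obtain ⟨c, hc, h1⟩ := (invPairSum_one_two_congr hp5 hh).exists_mem
  obtain ⟨d, hd, h2⟩ := (invPowSum_three_congr hp5 hh).exists_mem
  obtain ⟨b, hb, h5⟩ := (invPowSum_five_congr_bernoulli hp5 hh).exists_mem
  have m1 := mem_pIntegers_of_den_dvd hp5 (3 / 4) (by norm_num)
  have m2 := mem_pIntegers_of_den_dvd hp5 (341 / 240) (by norm_num)
  refine .of_eq (c := c - 3 / 4 * d + 341 / 240 * b) ?_ ?_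
  · apply_rules [sub_mem, add_mem, mul_mem, pow_mem, neg_mem]
  · linear_combination h1 - 3 / 4 * h2 + 341 / 240 * p ^ 2 * h5

end

theorem mainTheorem5 (p : ℕ) (hp : p.Prime) (hp5 : 5 < p) :
    RatCongr p 4 (multipleHarmonicSum (p - 1) ![2])
      (-2 * (multipleHarmonicSum (p - 1) ![1] / (p : ℚ))
        + (2 / 5 : ℚ) * (p : ℚ) ^ 3 * bernoulli (p - 5)) ∧
    RatCongr p 4 (multipleHarmonicSum ((p - 1) / 2) ![2])
      (-7 * (multipleHarmonicSum (p - 1) ![1] / (p : ℚ))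
        + (17 / 10 : ℚ) * (p : ℚ) ^ 3 * bernoulli (p - 5)) ∧
    RatCongr p 3 (multipleHarmonicSum ((p - 1) / 2) ![3])
      (6 * (multipleHarmonicSum (p - 1) ![1] / (p : ℚ) ^ 2)
        - (81 / 10 : ℚ) * (p : ℚ) ^ 2 * bernoulli (p - 5)) ∧
    RatCongr p 3
      (multipleHarmonicSum ((p - 1) / 2) ![1, 2]
        + (p : ℚ) * multipleHarmonicSum ((p - 1) / 2) ![1, 3])
      (-(9 / 2 : ℚ) * (multipleHarmonicSum (p - 1) ![1] / (p : ℚ) ^ 2)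
        - (49 / 20 : ℚ) * (p : ℚ) ^ 2 * bernoulli (p - 5)) := by
  have : Fact p.Prime := ⟨hp⟩
  obtain ⟨h, hh⟩ : ∃ h, p = 2 * h + 1 := hp.odd_of_ne_two (by omega)
  have h1 : (p - 1) / 2 = h := by omega
  have h2 : p - 1 = 2 * h := by omega
  rw [h1, h2]
  simp only [multipleHarmonicSum_one, multipleHarmonicSum_two]
  exact ⟨invPowSum_two_full_congr hp5 hh, invPowSum_two_congr hp5 hh,
    invPowSum_three_congr hp5 hh, invPairSum_congr hp5 hh⟩
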